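/- Let $k$ be a local function field of characteristic $p>0$, i.e. a non-archimedean local field of characteristic $p$. Let $P\in k[T_1,\dots,T_r]$ be a $p$-polynomial, i.e. a $k$-linear combination of monomials $T_i^{p^j}$ ($1\le i\le r$, $j\ge 0$), and suppose that $P$ is separable, i.e. for at least one $i$ the coefficient of $T_i$ in $P$ is nonzero. The principal part of $P$ is $P_{\mathrm{princ}}=\sum_{i=1}^r c_iT_i^{p^{m_i}}$, where $p^{m_i}$ is the highest power to which $T_i$ occurs in $P$ and $c_i\neq 0$ is its coefficient (the term is $0$ if $T_i$ does not occur). Let $M\ge 0$ and $r_1,\dots,r_M\ge 0$ be integers with $r_1+\dots+r_M=r$ such that, after reindexing the variables, $$P_{\mathrm{princ}}=\sum_{i=1}^{r_1} c_i T_i^{p^M}+\sum_{i=r_1+1}^{r_1+r_2} c_i T_i^{p^{M-1}}+\cdots+\sum_{i=r_1+\cdots+r_{M-1}+1}^{r_1+\cdots+r_M} c_i T_i^{p},$$ that is, exactly $r_j$ of the variables occur in $P_{\mathrm{princ}}$ with exponent $p^{M-j+1}$, for $j=1,\dots,M$. Assume that $P_{\mathrm{princ}}(x)\neq 0$ for all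 $x\in k^r\setminus\{0\}$. Let $\operatorname{im}P=\{P(x): x\in k^r\}$, a subgroup of the additive group of $k$. Then $$r_1+p\,r_2+\cdots+p^{M-1}r_M\le p^M,$$ and equality holds if and only if the quotient group $k/\operatorname{im}P$ is finite. -/

import Mathlib

namespace PPoly

open MvPolynomial

variable {σ k : Type*} [Field k]

/-- `P` is a `p`-polynomial: a `k`-linear combination of the monomials `x_i ^ (p ^ j)`. -/
def IsPPolynomial (p : ℕ) (P : MvPolynomial σ k) : Prop :=
  P ∈ Submodule.span k {Q : MvPolynomial σ k | ∃ (i : σ) (j : ℕ), Q = X i ^ p ^ j}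

/-- A `p`-polynomial is separable if its linear part is nonzero, that is, if some variable
occurs in degree one with a nonzero coefficient. -/
def IsSeparable (P : MvPolynomial σ k) : Prop :=
  ∃ i : σ, P.coeff (Finsupp.single i 1) ≠ 0

/-- The principal part of a `p`-polynomial: the sum over the variables `x_i` of the term of `P` in
which `x_i` occurs to its highest power (`0` for a variable that does not occur, since a
`p`-polynomial has no constant term). -/
noncomputable def principalPart [Fintype σ] (P : MvPolynomial σ k) : MvPolynomial σ k :=
  ∑ i : σ, C (P.coeff (Finsupp.single i (P.degreeOf i))) * X i ^ P.degreeOf i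

/-- In characteristic `p`, a `p`-polynomial is additive as a function. -/
theorem IsPPolynomial.eval_add {p : ℕ} [Fact p.Prime] [CharP k p] {P : MvPolynomial σ k}
    (hP : IsPPolynomial p P) (x y : σ → k) : eval (x + y) P = eval x P + eval y P := by
  unfold IsPPolynomial at hP
  induction hP using Submodule.span_induction with
  | mem Q hQ =>
    obtain ⟨i, j, rfl⟩ := hQ
    simp [add_pow_char_pow]
  | zero => simp
  | add Q R _ _ hQ hR => simp only [map_add, hQ, hR]; ring
  | smul a Q _ hQ => simp only [smul_eval, hQ]; ring

/-- The image `im P` of the additive map `k^σ → k` given by a `p`-polynomial `P`, a subgroup of the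
additive group of `k`. -/
noncomputable def im {p : ℕ} [Fact p.Prime] [CharP k p] {P : MvPolynomial σ k}
    (hP : IsPPolynomial p P) : AddSubgroup k :=
  (AddMonoidHom.mk' (fun x : σ → k => eval x P) hP.eval_add).range

end PPoly

/-! Write `F = ∑ c_i x_i ^ (p ^ m_i)` for the principal part and `L` for the remaining terms of `P`;
`F` is additive without nontrivial zeros, hence injective. Since `1, π, ..., π ^ (p ^ M - 1)` is a
basis of `k` over `k ^ (p ^ M)`, the bijective substitution `x_i = ∑_j π ^ j y_ij ^ (p ^ (M - m_i))`
turns `F` into an injective `k ^ (p ^ M)`-linear map from a space of dimension `∑ p ^ (M - m_i)`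
into `k`, of dimension `p ^ M`. This gives the inequality, with equality iff `F` is surjective
(`surjective_iff_sum_pow_eq`).

It remains to see that `F` is surjective iff `k / im P` is finite. By compactness `F` is bounded
below (`exists_bound_of_injective`), so `L` is negligible against large values of `F`. If `F` is
onto, a large `F x` is congruent to the smaller `-L x`, so a ball meets every class of the open
subgroup `im P`. If `F` misses `y₀`, then `y₀ s ^ (p ^ M) + F x` is still injective, which keeps the
multiples `y₀ s ^ (p ^ M)` with `s` large out of finitely many classes. -/

/-! ### Expansions in powers of a uniformizer with `p ^ m`-th power coefficients -/

section Expand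

variable {k : Type*} [Field k] (p : ℕ) [Fact p.Prime] [CharP k p]

/-- The map `y ↦ ∑ y_j ^ (p ^ m) π ^ j`. -/
def unifExpand (π : k) (m : ℕ) : (Fin (p ^ m) → k) →+ k :=
  AddMonoidHom.mk' (fun y => ∑ j, y j ^ p ^ m * π ^ (j : ℕ)) fun x y => by
    simp [add_pow_char_pow, add_mul, Finset.sum_add_distrib]

theorem unifExpand_apply (π : k) (m : ℕ) (y : Fin (p ^ m) → k) :
    unifExpand p π m y = ∑ j, y j ^ p ^ m * π ^ (j : ℕ) := rfl

theorem unifExpand_smul (π : k) (m : ℕ) (z : k) (y : Fin (p ^ m) → k) :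
    unifExpand p π m (z • y) = z ^ p ^ m * unifExpand p π m y := by
  simp [unifExpand_apply, mul_pow, Finset.mul_sum, mul_assoc]

end Expand

section LocalField

open ValuativeRel Topology

variable {k : Type*} [Field k] [ValuativeRel k]

/-- An element of maximal valuation `< 1`, the valuation of which generates the value group. -/
structure IsUnif (π : k) : Prop where
  ne_zero : π ≠ 0
  lt_one : valuation k π < 1
  le_of_lt_one : ∀ x : k, valuation k x < 1 → valuation k x ≤ valuation k π
  exists_zpow : ∀ x : k, x ≠ 0 → ∃ n : ℤ, valuation k x = valuation k π ^ n

theorem IsUnif.pos {π : k} (h : IsUnif π) : 0 < valuation k π :=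
  zero_lt_iff.2 ((Valuation.ne_zero_iff _).2 h.ne_zero)

section Independence

variable (p : ℕ) [Fact p.Prime] [CharP k p]

/-- The nonzero terms have valuation exponents in distinct classes modulo `p ^ m`, so one of them
strictly dominates and the sum cannot vanish. -/
theorem unifExpand_injective {π : k} (hπ : IsUnif π) (m : ℕ) :
    Function.Injective (unifExpand p π m) := by
  classical
  rw [injective_iff_map_eq_zero]
  intro y hy
  by_contra hne
  obtain ⟨i, hi⟩ := Function.ne_iff.1 hne
  obtain ⟨j, -, hj⟩ := Finset.exists_max_image Finset.univ
    (fun j => valuation k (y j ^ p ^ m * π ^ (j : ℕ))) ⟨i, Finset.mem_univ i⟩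
  have hj0 : y j ≠ 0 := by
    intro h0
    have := hj i (Finset.mem_univ i)
    simp [h0, hπ.ne_zero, (Fact.out : p.Prime).ne_zero] at this
    exact hi this
  have key : ∀ l ≠ j, valuation k (y l ^ p ^ m * π ^ (l : ℕ)) <
      valuation k (y j ^ p ^ m * π ^ (j : ℕ)) := by
    intro l hl
    refine (hj l (Finset.mem_univ l)).lt_of_ne fun heq => ?_
    have hl0 : y l ≠ 0 := by
      rintro h0
      simp [h0, hπ.ne_zero, hj0, (Fact.out : p.Prime).ne_zero] at heq
    obtain ⟨a, ha⟩ := hπ.exists_zpow _ hj0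
    obtain ⟨b, hb⟩ := hπ.exists_zpow _ hl0
    rw [map_mul, map_mul, map_pow, map_pow, map_pow, map_pow, ha, hb] at heq
    simp only [← zpow_natCast, ← zpow_mul] at heq
    rw [← zpow_add₀ hπ.pos.ne', ← zpow_add₀ hπ.pos.ne'] at heq
    have := (zpow_right_strictAnti₀ hπ.pos hπ.lt_one).injective heq
    apply hl
    have h1 : ((l : ℕ) : ℤ) % ((p ^ m : ℕ) : ℤ) = ((j : ℕ) : ℤ) % ((p ^ m : ℕ) : ℤ) := by
      rw [← Int.add_mul_emod_self_right _ b, ← Int.add_mul_emod_self_right (j : ℤ) a]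
      congr 1
      linarith
    rw [Int.emod_eq_of_lt (by positivity) (by exact_mod_cast l.2),
      Int.emod_eq_of_lt (by positivity) (by exact_mod_cast j.2)] at h1
    exact Fin.ext (by exact_mod_cast h1)
  have hv := Valuation.map_sum_eq_of_lt (valuation k) (s := Finset.univ) (j := j)
    (f := fun j => y j ^ p ^ m * π ^ (j : ℕ)) (Finset.mem_univ j) (by
      intro l hl
      exact key l (by simpa using hl))
  rw [← unifExpand_apply, hy] at hv
  simp [hj0, hπ.ne_zero] at hv

end Independence

variable [TopologicalSpace k] [IsNonarchimedeanLocalField k]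

variable (k) in
theorem exists_isUnif : ∃ π : k, IsUnif π := by
  let e := IsNonarchimedeanLocalField.valueGroupWithZeroIsoInt k
  obtain ⟨π, hπ⟩ := valuation_surjective (e.symm (WithZero.exp (-1)))
  have heπ : e (valuation k π) = WithZero.exp (-1) := by rw [hπ]; simp [-WithZero.exp_neg]
  have key : ∀ x : k, x ≠ 0 → ∃ n : ℤ, e (valuation k x) = WithZero.exp n := fun x hx => by
    have h0 : e (valuation k x) ≠ 0 := by simpa using hx
    exact ⟨WithZero.log (e (valuation k x)), (WithZero.exp_log h0).symm⟩
  refine ⟨π, ⟨?_, ?_, ?_, ?_⟩⟩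
  · rintro rfl
    rw [map_zero, map_zero] at heπ
    exact WithZero.exp_ne_zero heπ.symm
  · rw [← e.strictMono.lt_iff_lt, heπ, map_one, ← WithZero.exp_zero, WithZero.exp_lt_exp]
    norm_num
  · intro x hx
    rcases eq_or_ne x 0 with rfl | h0
    · simp
    obtain ⟨n, hn⟩ := key x h0
    rw [← e.strictMono.lt_iff_lt, hn, map_one, ← WithZero.exp_zero, WithZero.exp_lt_exp] at hx
    rw [← e.strictMono.le_iff_le, hn, heπ, WithZero.exp_le_exp]
    omega
  · intro x hx
    obtain ⟨n, hn⟩ := key x hx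
    refine ⟨-n, e.injective ?_⟩
    have h1 : e (valuation k π ^ (-n)) = e (valuation k π) ^ (-n) :=
      map_zpow₀ e.toMulEquiv _ _
    change e _ = e _
    rw [h1, hn, heπ, ← WithZero.exp_zsmul]
    simp

variable (k) in
theorem t2Space_of_isNonarchimedeanLocalField : T2Space k := by
  let := IsTopologicalAddGroup.rightUniformSpace k
  have := isUniformAddGroup_of_addCommGroup (G := k)
  infer_instance

theorem isOpen_of_ball_subset {H : AddSubgroup k} {ρ : ValueGroupWithZero k} (hρ : ρ ≠ 0)
    (h : ∀ y, valuation k y ≤ ρ → y ∈ H) : IsOpen (H : Set k) := by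
  apply AddSubgroup.isOpen_of_mem_nhds H (g := 0)
  rw [IsValuativeTopology.mem_nhds_zero_iff]
  exact ⟨Units.mk0 ρ hρ, fun y hy => h y (le_of_lt hy)⟩

/-- The closed ball of radius `γ` around the origin, as an additive subgroup. -/
def closedBallSubgroup (γ : ValueGroupWithZero k) : AddSubgroup k where
  carrier := {x | valuation k x ≤ γ}
  add_mem' {a b} ha hb := ((valuation k).map_add a b).trans (max_le ha hb)
  zero_mem' := by simp
  neg_mem' h := by simpa using h

theorem exists_le_pow_uniformizer {π : k} (hπ : IsUnif π) {γ : ValueGroupWithZero k} (hγ : γ ≠ 0)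
    (ρ : ValueGroupWithZero k) : ∃ n : ℕ, valuation k π ^ n * ρ ≤ γ := by
  obtain ⟨n, hn⟩ := MulArchimedean.arch (ρ / γ)
    (y := (valuation k π)⁻¹) ((one_lt_inv₀ hπ.pos).2 hπ.lt_one)
  refine ⟨n, ?_⟩
  have h0 : 0 < valuation k π ^ n := pow_pos hπ.pos n
  rwa [inv_pow, div_le_iff₀ (zero_lt_iff.2 hγ), inv_mul_eq_div, le_div_iff₀ h0, mul_comm] at hn

/-- Successive approximation: a closed subgroup which approximates every element of a ball
contains the ball. -/
theorem mem_of_approx {π : k} (hπ : IsUnif π) {S : AddSubgroup k} (hS : IsClosed (S : Set k))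
    {ρ : ValueGroupWithZero k}
    (h : ∀ y, valuation k y ≤ ρ → ∃ s ∈ S, valuation k (y - s) ≤ valuation k π * valuation k y)
    {y : k} (hy : valuation k y ≤ ρ) : y ∈ S := by
  have step : ∀ n : ℕ, ∃ s ∈ S, valuation k (y - s) ≤ valuation k π ^ n * ρ := by
    intro n
    induction n with
    | zero => exact ⟨0, S.zero_mem, by simpa using hy⟩
    | succ n ih =>
      obtain ⟨s, hs, hsy⟩ := ih
      have h1 : valuation k π ^ n * ρ ≤ ρ := mul_le_of_le_one_left' (pow_le_one' hπ.lt_one.le n)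
      obtain ⟨t, ht, hty⟩ := h (y - s) (hsy.trans h1)
      refine ⟨s + t, S.add_mem hs ht, ?_⟩
      rw [← sub_sub, pow_succ', mul_assoc]
      exact hty.trans (mul_le_mul_right hsy _)
  have : y ∈ closure (S : Set k) := by
    rw [mem_closure_iff_nhds_basis (IsValuativeTopology.hasBasis_nhds y)]
    rintro γ -
    obtain ⟨n, hn⟩ := exists_le_pow_uniformizer hπ (mul_ne_zero hπ.pos.ne' γ.ne_zero) ρ
    obtain ⟨s, hs, hsy⟩ := step n
    refine ⟨s, hs, ?_⟩
    rw [Set.mem_ofPred_eq, Valuation.map_sub_swap]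
    refine (hsy.trans hn).trans_lt ?_
    exact mul_lt_of_lt_one_left γ.zero_lt hπ.lt_one
  rwa [hS.closure_eq] at this

variable (p : ℕ) [Fact p.Prime] [CharP k p]

/-- Frobenius is bijective on the finite residue field. -/
theorem pow_char_pow_residue_surjective (m : ℕ) (u : k) (hu : valuation k u ≤ 1) :
    ∃ w : k, valuation k w ≤ 1 ∧ valuation k (u - w ^ p ^ m) < 1 := by
  have : CharP 𝒪[k] p := inferInstance
  have : CharP 𝓀[k] p := by
    rw [CharP.charP_iff_prime_eq_zero Fact.out, ← map_natCast (IsLocalRing.residue 𝒪[k])]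
    simp
  have hsurj : Function.Surjective (iterateFrobenius 𝓀[k] p m) :=
    Finite.surjective_of_injective (iterateFrobenius 𝓀[k] p m).injective
  obtain ⟨w, hw⟩ := hsurj (IsLocalRing.residue 𝒪[k] ⟨u, hu⟩)
  obtain ⟨w, rfl⟩ := IsLocalRing.residue_surjective w
  refine ⟨w, w.2, ?_⟩
  rw [iterateFrobenius_def, eq_comm, ← sub_eq_zero, ← map_pow, ← map_sub,
    IsLocalRing.residue_eq_zero_iff, IsLocalRing.mem_maximalIdeal, mem_nonunits_iff,
    Valuation.Integers.isUnit_iff_valuation_eq_one (Valuation.integer.integers _)] at hw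
  have hle : (⟨u, hu⟩ - w ^ p ^ m : 𝒪[k]).1 ∈ 𝒪[k] := (⟨u, hu⟩ - w ^ p ^ m : 𝒪[k]).2
  exact lt_of_le_of_ne hle hw

theorem continuous_unifExpand (π : k) (m : ℕ) : Continuous (unifExpand p π m) := by
  change Continuous fun y : Fin (p ^ m) → k => ∑ j, y j ^ p ^ m * π ^ (j : ℕ)
  fun_prop

/-- The image of the integral box is compact, hence closed, so successive approximation shows that
it contains the unit ball. Homogeneity under `p ^ m`-th powers then reaches all of `k`. -/
theorem unifExpand_surjective {π : k} (hπ : IsUnif π) (m : ℕ) :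
    Function.Surjective (unifExpand p π m) := by
  classical
  have := t2Space_of_isNonarchimedeanLocalField k
  have hq : 0 < p ^ m := pow_pos (Fact.out : p.Prime).pos m
  let B : AddSubgroup (Fin (p ^ m) → k) :=
    AddSubgroup.pi Set.univ fun _ => closedBallSubgroup (1 : ValueGroupWithZero k)
  have hB : IsCompact (B : Set (Fin (p ^ m) → k)) :=
    isCompact_univ_pi (s := fun _ => {x : k | valuation k x ≤ 1})
      fun _ => IsNonarchimedeanLocalField.isCompact_closedBall k 1
  have hS : IsClosed ((B.map (unifExpand p π m) : AddSubgroup k) : Set k) :=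
    (hB.image (continuous_unifExpand p π m)).isClosed
  have hball : ∀ y, valuation k y ≤ 1 → y ∈ B.map (unifExpand p π m) := by
    intro y hy
    refine mem_of_approx hπ hS (fun y hy => ?_) hy
    rcases eq_or_ne y 0 with rfl | h0
    · exact ⟨0, AddSubgroup.zero_mem _, by simp⟩
    obtain ⟨n, hn⟩ := hπ.exists_zpow y h0
    have hn0 : 0 ≤ n := by
      by_contra hlt
      have := one_lt_zpow_of_neg₀ hπ.pos hπ.lt_one (not_le.1 hlt)
      exact absurd hy (not_le.2 (hn ▸ this))
    lift n to ℕ using hn0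
    rw [zpow_natCast] at hn
    have hπn : valuation k π ^ n ≠ 0 := pow_ne_zero _ hπ.pos.ne'
    obtain ⟨w, hw1, hw⟩ := pow_char_pow_residue_surjective p m (y / π ^ n)
      (by rw [map_div₀, map_pow, hn, div_self hπn])
    -- Division of `n` by `p ^ m`: the remainder selects the power of `π`, the quotient goes into
    -- the coefficient.
    refine ⟨_, ⟨Pi.single ⟨n % p ^ m, Nat.mod_lt _ hq⟩ (w * π ^ (n / p ^ m)), ?_, rfl⟩, ?_⟩
    · intro j _
      rcases eq_or_ne j ⟨n % p ^ m, Nat.mod_lt _ hq⟩ with rfl | hj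
      · change valuation k (Pi.single (M := fun _ => k) _ _ _) ≤ 1
        rw [Pi.single_eq_same, map_mul, map_pow]
        exact mul_le_one' hw1 (pow_le_one' hπ.lt_one.le _)
      · change valuation k (Pi.single (M := fun _ => k) _ _ _) ≤ 1
        simp [Pi.single_eq_of_ne hj]
    · have h1 : unifExpand p π m (Pi.single ⟨n % p ^ m, Nat.mod_lt _ hq⟩ (w * π ^ (n / p ^ m)))
          = π ^ n * w ^ p ^ m := by
        rw [unifExpand_apply, Finset.sum_eq_single ⟨n % p ^ m, Nat.mod_lt _ hq⟩]
        · rw [Pi.single_eq_same, mul_pow, ← pow_mul, mul_assoc, ← pow_add, mul_comm]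
          congr 2
          rw [mul_comm]
          exact Nat.div_add_mod _ _
        · intro j _ hj
          rw [Pi.single_eq_of_ne hj, zero_pow hq.ne', zero_mul]
        · simp
      have h2 : y - π ^ n * w ^ p ^ m = (y / π ^ n - w ^ p ^ m) * π ^ n := by
        rw [sub_mul, div_mul_cancel₀ _ (pow_ne_zero _ hπ.ne_zero), mul_comm (π ^ n)]
      rw [h1, h2, map_mul, map_pow, hn]
      exact mul_le_mul_left (hπ.le_of_lt_one _ hw) _
  intro y
  obtain ⟨n, hn⟩ := exists_le_pow_uniformizer hπ one_ne_zero (valuation k y)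
  obtain ⟨x, -, hx⟩ := hball ((π ^ n) ^ p ^ m * y) (by
    rw [map_mul, map_pow, map_pow]
    refine le_trans (mul_le_mul_left ?_ _) hn
    exact pow_le_of_le_one zero_le (pow_le_one' hπ.lt_one.le n) hq.ne')
  refine ⟨(π ^ n)⁻¹ • x, ?_⟩
  rw [unifExpand_smul, hx, inv_pow, inv_mul_cancel_left₀]
  exact pow_ne_zero _ (pow_ne_zero _ hπ.ne_zero)

end LocalField

/-! ### Additive forms as linear maps over the field of `p ^ M`-th powers -/

section Additive

variable {k : Type*} [Field k] (p : ℕ) [Fact p.Prime] [CharP k p]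

/-- The additive form `∑ c_i x_i ^ (p ^ m_i)`. -/
def diagForm {ι : Type*} [Fintype ι] (c : ι → k) (m : ι → ℕ) : (ι → k) →+ k :=
  AddMonoidHom.mk' (fun x => ∑ i, c i * x i ^ p ^ m i) fun x y => by
    simp [add_pow_char_pow, mul_add, Finset.sum_add_distrib]

variable {ι : Type*} [Fintype ι]

theorem diagForm_apply (c : ι → k) (m : ι → ℕ) (x : ι → k) :
    diagForm p c m x = ∑ i, c i * x i ^ p ^ m i := rfl

theorem diagForm_const_smul (c : ι → k) (M : ℕ) (z : k) (x : ι → k) :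
    diagForm p c (fun _ => M) (z • x) = z ^ p ^ M * diagForm p c (fun _ => M) x := by
  simp [diagForm_apply, mul_pow, Finset.mul_sum, mul_left_comm]

theorem continuous_diagForm [TopologicalSpace k] [IsTopologicalRing k] (c : ι → k) (m : ι → ℕ) :
    Continuous (diagForm p c m) := by
  change Continuous fun x : ι → k => ∑ i, c i * x i ^ p ^ m i
  fun_prop

/-- The subfield of `p ^ M`-th powers. -/
abbrev powField (k : Type*) [Field k] (p : ℕ) [Fact p.Prime] [CharP k p] (M : ℕ) : Subfield k :=
  (iterateFrobenius k p M).fieldRange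

/-- The element `y ^ (p ^ M)` of the subfield of `p ^ M`-th powers. -/
def toPowField (M : ℕ) (y : k) : powField k p M := ⟨y ^ p ^ M, y, iterateFrobenius_def p M y⟩

theorem toPowField_surjective (M : ℕ) : Function.Surjective (toPowField (k := k) p M) := by
  rintro ⟨_, y, rfl⟩
  exact ⟨y, Subtype.ext (iterateFrobenius_def p M y).symm⟩

theorem sum_toPowField_smul (M : ℕ) (e y : ι → k) :
    ∑ s, toPowField p M (y s) • e s = diagForm p e (fun _ => M) y := by
  simp only [diagForm_apply]
  exact Finset.sum_congr rfl fun s _ => mul_comm _ _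

theorem linearIndependent_powField_iff {M : ℕ} {e : ι → k} :
    LinearIndependent (powField k p M) e ↔
      Function.Injective (diagForm p e fun _ => M) := by
  have hp0 : p ^ M ≠ 0 := pow_ne_zero _ (Fact.out : p.Prime).ne_zero
  rw [Fintype.linearIndependent_iff, injective_iff_map_eq_zero]
  constructor
  · intro h y hy
    rw [← sum_toPowField_smul] at hy
    funext s
    have := congrArg Subtype.val (h _ hy s)
    exact (pow_eq_zero_iff hp0).1 this
  · intro h g hg s
    choose y hy using fun s => toPowField_surjective (k := k) p M (g s)
    simp only [← hy] at hg ⊢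
    rw [sum_toPowField_smul] at hg
    have := congrFun (h y hg) s
    refine Subtype.ext ?_
    change y s ^ p ^ M = 0
    rw [this, Pi.zero_apply, zero_pow hp0]

theorem span_powField_eq_top_iff {M : ℕ} {e : ι → k} :
    Submodule.span (powField k p M) (Set.range e) = ⊤ ↔
      Function.Surjective (diagForm p e fun _ => M) := by
  rw [Submodule.eq_top_iff']
  refine forall_congr' fun x => ?_
  rw [Submodule.mem_span_range_iff_exists_fun]
  constructor
  · rintro ⟨g, hg⟩
    choose y hy using fun s => toPowField_surjective (k := k) p M (g s)
    exact ⟨y, by rw [← hg, ← sum_toPowField_smul]; simp only [hy]⟩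
  · rintro ⟨y, hy⟩
    exact ⟨fun s => toPowField p M (y s), by rw [sum_toPowField_smul, hy]⟩

theorem unifExpand_eq_diagForm (π : k) (m : ℕ) (y : Fin (p ^ m) → k) :
    unifExpand p π m y = diagForm p (fun j : Fin (p ^ m) => π ^ (j : ℕ)) (fun _ => m) y := by
  simp only [unifExpand_apply, diagForm_apply, mul_comm]

/-- The coordinate change `x_i = ∑_j π ^ j y_(i, j) ^ (p ^ (M - m_i))`. -/
theorem diagForm_unifExpand (π : k) (c : ι → k) {m : ι → ℕ} {M : ℕ} (hm : ∀ i, m i ≤ M)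
    (y : (Σ i, Fin (p ^ (M - m i))) → k) :
    diagForm p c m (fun i => unifExpand p π (M - m i) fun j => y ⟨i, j⟩) =
      diagForm p (fun s : Σ i, Fin (p ^ (M - m i)) => c s.1 * (π ^ (s.2 : ℕ)) ^ p ^ m s.1)
        (fun _ => M) y := by
  simp only [diagForm_apply, unifExpand_apply, Fintype.sum_sigma, sum_pow_char_pow, Finset.mul_sum]
  refine Finset.sum_congr rfl fun i _ => Finset.sum_congr rfl fun j _ => ?_
  rw [mul_pow, ← pow_mul, ← pow_add, Nat.sub_add_cancel (hm i)]
  ring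

theorem diagForm_family_eq {π : k} (c : ι → k) {m : ι → ℕ} {M : ℕ} (hm : ∀ i, m i ≤ M) :
    (diagForm p (fun s : Σ i, Fin (p ^ (M - m i)) => c s.1 * (π ^ (s.2 : ℕ)) ^ p ^ m s.1)
        (fun _ => M) : _ → k) =
    diagForm p c m ∘ fun (y : (Σ i, Fin (p ^ (M - m i))) → k) (i : ι) =>
      unifExpand p π (M - m i) fun j => y ⟨i, j⟩ :=
  funext fun y => (diagForm_unifExpand p π c hm y).symm

/-- A zero with nonzero new coordinate `s` could be divided by `s ^ (p ^ M)`, exhibiting `y₀` as a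
value of the old form. -/
theorem injective_diagForm_option {c : ι → k} {m : ι → ℕ} {M : ℕ} (hm : ∀ i, m i ≤ M)
    (hinj : Function.Injective (diagForm p c m)) {y₀ : k} (hy₀ : y₀ ∉ Set.range (diagForm p c m)) :
    Function.Injective (diagForm p (fun o : Option ι => o.elim y₀ c) fun o => o.elim M m) := by
  have hp0 : p ^ M ≠ 0 := pow_ne_zero _ (Fact.out : p.Prime).ne_zero
  rw [injective_iff_map_eq_zero]
  intro x hx
  have hx' : y₀ * x none ^ p ^ M + diagForm p c m (fun i => x (some i)) = 0 := by
    rwa [diagForm_apply, Fintype.sum_option] at hx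
  by_cases h0 : x none = 0
  · rw [h0, zero_pow hp0, mul_zero, zero_add, ← map_zero (diagForm p c m)] at hx'
    funext o
    cases o with
    | none => exact h0
    | some i => exact congrFun (hinj hx') i
  · refine absurd ⟨-(fun i => x (some i) / x none ^ p ^ (M - m i)), ?_⟩ hy₀
    rw [map_neg, diagForm_apply]
    simp only [div_pow, ← pow_mul, ← pow_add, Nat.sub_add_cancel (hm _), mul_div_assoc']
    rw [← Finset.sum_div, ← diagForm_apply, neg_eq_iff_eq_neg,
      div_eq_iff (pow_ne_zero _ h0)]
    linear_combination hx'

end Additive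

/-! ### Dimension count and lower bounds for injective forms -/

section LocalField

open ValuativeRel Topology

variable {k : Type*} [Field k] [ValuativeRel k] [TopologicalSpace k] [IsNonarchimedeanLocalField k]
variable (p : ℕ) [Fact p.Prime] [CharP k p]

variable (k) in
theorem finrank_powField (M : ℕ) :
    Module.Finite (powField k p M) k ∧ Module.finrank (powField k p M) k = p ^ M := by
  obtain ⟨π, hπ⟩ := exists_isUnif k
  have he : (unifExpand p π M : (Fin (p ^ M) → k) → k) =
      diagForm p (fun j : Fin (p ^ M) => π ^ (j : ℕ)) (fun _ => M) :=
    funext (unifExpand_eq_diagForm p π M)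
  have h1 := unifExpand_injective p hπ M
  have h2 := unifExpand_surjective p hπ M
  rw [he] at h1 h2
  let b := Module.Basis.mk ((linearIndependent_powField_iff p).2 h1)
    ((span_powField_eq_top_iff p).2 h2).ge
  exact ⟨b.finiteDimensional_of_finite, by rw [Module.finrank_eq_card_basis b, Fintype.card_fin]⟩

theorem bijective_unifExpand_family {ι : Type*} {π : k} (hπ : IsUnif π) (m : ι → ℕ) (M : ℕ) :
    Function.Bijective fun (y : (Σ i, Fin (p ^ (M - m i))) → k) (i : ι) =>
      unifExpand p π (M - m i) fun j => y ⟨i, j⟩ := by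
  constructor
  · intro y z h
    funext ⟨i, j⟩
    exact congrFun (unifExpand_injective p hπ _ (congrFun h i)) j
  · intro x
    choose y hy using fun i => unifExpand_surjective p hπ (M - m i) (x i)
    exact ⟨fun s => y s.1 s.2, funext hy⟩

variable {ι : Type*} [Fintype ι]

/-- After the coordinate change the coefficients are linearly independent over `powField k p M`, and
their number is at most the degree `p ^ M`. -/
theorem sum_pow_le_of_injective {c : ι → k} {m : ι → ℕ} {M : ℕ} (hm : ∀ i, m i ≤ M)
    (h : Function.Injective (diagForm p c m)) : ∑ i, p ^ (M - m i) ≤ p ^ M := by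
  obtain ⟨π, hπ⟩ := exists_isUnif k
  obtain ⟨_, hr⟩ := finrank_powField k p M
  have hinj := h.comp (bijective_unifExpand_family p hπ m M).1
  rw [← diagForm_family_eq p c hm, ← linearIndependent_powField_iff] at hinj
  simpa [hr] using hinj.fintype_card_le_finrank

theorem surjective_iff_sum_pow_eq {c : ι → k} {m : ι → ℕ} {M : ℕ} (hm : ∀ i, m i ≤ M)
    (h : Function.Injective (diagForm p c m)) :
    Function.Surjective (diagForm p c m) ↔ ∑ i, p ^ (M - m i) = p ^ M := by
  obtain ⟨π, hπ⟩ := exists_isUnif k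
  obtain ⟨_, hr⟩ := finrank_powField k p M
  have hbij := bijective_unifExpand_family p hπ m M
  have hinj := h.comp hbij.1
  rw [← diagForm_family_eq p c hm, ← linearIndependent_powField_iff] at hinj
  rw [← hbij.2.of_comp_iff, ← diagForm_family_eq p c hm, ← span_powField_eq_top_iff, ← hr]
  have hcard : Fintype.card (Σ i, Fin (p ^ (M - m i))) = ∑ i, p ^ (M - m i) := by simp
  rw [← hcard]
  constructor
  · intro hs
    exact (Module.finrank_eq_card_basis (Module.Basis.mk hinj hs.ge)).symm
  · exact hinj.span_eq_top_of_card_eq_finrank'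

/-- An injective additive form of constant degree is bounded below. -/
theorem exists_bound_of_injective_const {e : ι → k} {M : ℕ}
    (h : Function.Injective (diagForm p e fun _ => M)) :
    ∃ C : ValueGroupWithZero k, C ≠ 0 ∧
      ∀ y i, valuation k (y i) ^ p ^ M ≤ C * valuation k (diagForm p e (fun _ => M) y) := by
  classical
  have := t2Space_of_isNonarchimedeanLocalField k
  have hp0 : p ^ M ≠ 0 := pow_ne_zero _ (Fact.out : p.Prime).ne_zero
  -- Integral vectors with some coordinate `1`: a compact set avoiding `0`, so its image stays away
  -- from `0`. Dividing by a largest coordinate brings any nonzero vector into `S`.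
  let S : Set (ι → k) := (Set.univ.pi fun _ => {x | valuation k x ≤ 1}) ∩ ⋃ i, {y | y i = 1}
  have hS : IsCompact S := by
    refine (isCompact_univ_pi fun _ =>
      IsNonarchimedeanLocalField.isCompact_closedBall k 1).inter_right ?_
    exact isClosed_iUnion_of_finite fun i => isClosed_eq (continuous_apply i) continuous_const
  have hF : (diagForm p e (fun _ => M) '' S)ᶜ ∈ 𝓝 (0 : k) := by
    refine (hS.image (continuous_diagForm p e _)).isClosed.isOpen_compl.mem_nhds ?_
    rintro ⟨y, ⟨-, hy⟩, hy0⟩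
    rw [← map_zero (diagForm p e fun _ => M)] at hy0
    rw [h hy0] at hy
    simp at hy
  rw [IsValuativeTopology.mem_nhds_zero_iff] at hF
  obtain ⟨γ, hγ⟩ := hF
  refine ⟨(γ : ValueGroupWithZero k)⁻¹, by simp, fun y i => ?_⟩
  obtain ⟨j, -, hj⟩ := Finset.exists_max_image Finset.univ (fun j => valuation k (y j))
    ⟨i, Finset.mem_univ i⟩
  refine le_trans (pow_le_pow_left' (hj i (Finset.mem_univ i)) _) ?_
  rcases eq_or_ne (y j) 0 with h0 | h0
  · rw [h0, map_zero, zero_pow hp0]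
    exact zero_le
  have hv0 : 0 < valuation k (y j) := zero_lt_iff.2 ((Valuation.ne_zero_iff _).2 h0)
  have hmem : (y j)⁻¹ • y ∈ S := by
    refine ⟨fun l _ => ?_, Set.mem_iUnion.2 ⟨j, by simp [h0]⟩⟩
    change valuation k ((y j)⁻¹ * y l) ≤ 1
    rw [map_mul, map_inv₀, inv_mul_le_iff₀ hv0, mul_one]
    exact hj l (Finset.mem_univ l)
  have hlow : (γ : ValueGroupWithZero k) ≤
      valuation k (diagForm p e (fun _ => M) ((y j)⁻¹ • y)) := by
    by_contra hlt
    exact hγ (not_le.1 hlt) ⟨_, hmem, rfl⟩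
  rw [diagForm_const_smul, map_mul, map_pow, map_inv₀, inv_pow, le_inv_mul_iff₀ (pow_pos hv0 _)]
    at hlow
  rwa [inv_mul_eq_div, le_div_iff₀ γ.zero_lt]

/-- An injective additive form is bounded below. -/
theorem exists_bound_of_injective {c : ι → k} {m : ι → ℕ}
    (h : Function.Injective (diagForm p c m)) :
    ∃ C : ValueGroupWithZero k, C ≠ 0 ∧
      ∀ x i, valuation k (x i) ^ p ^ m i ≤ C * valuation k (diagForm p c m x) := by
  obtain ⟨π, hπ⟩ := exists_isUnif k
  obtain ⟨M, hM⟩ : ∃ M, ∀ i, m i ≤ M :=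
    ⟨Finset.univ.sup m, fun i => Finset.le_sup (Finset.mem_univ i)⟩
  have hbij := bijective_unifExpand_family p hπ m M
  have hinj := h.comp hbij.1
  rw [← diagForm_family_eq p c hM] at hinj
  obtain ⟨C, hC0, hC⟩ := exists_bound_of_injective_const p hinj
  refine ⟨C, hC0, fun x i => ?_⟩
  obtain ⟨y, rfl⟩ := hbij.2 x
  have h1 := hC y
  rw [← diagForm_unifExpand p π c hM] at h1
  simp only [unifExpand_apply, ← map_pow, sum_pow_char_pow] at h1 ⊢
  -- `x_i ^ (p ^ m_i)` is the sum of the `y_ij ^ (p ^ M) π ^ (j p ^ m_i)`, and the ultrametric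
  -- inequality allows bounding each term separately.
  refine Valuation.map_sum_le _ fun j _ => le_trans ?_ (h1 ⟨i, j⟩)
  rw [mul_pow, ← pow_mul, ← pow_add, Nat.sub_add_cancel (hM i), map_mul]
  refine mul_le_of_le_one_right' ?_
  rw [map_pow, map_pow]
  exact pow_le_one' (pow_le_one' hπ.lt_one.le _) _

end LocalField

/-! ### Finiteness of the quotient versus surjectivity of the principal part -/

section Quotient

open ValuativeRel Topology

variable {k : Type*} [Field k] [ValuativeRel k]
variable {p : ℕ} [Fact p.Prime]

/-- For `x` beyond the threshold `T`, one extra factor of `x` absorbs `a / ε`; below it the term is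
bounded, and `R` is chosen to dominate that bound. -/
theorem exists_lower_term_bound (a : k) {j m : ℕ} (hjm : j < m) {ε : ValueGroupWithZero k}
    (hε : ε ≠ 0) : ∃ R : ValueGroupWithZero k, ∀ (x : k) (G : ValueGroupWithZero k),
      valuation k x ^ p ^ m ≤ G → R ≤ G → valuation k (a * x ^ p ^ j) ≤ ε * G := by
  have hε0 : 0 < ε := zero_lt_iff.2 hε
  set T : ValueGroupWithZero k := max 1 (valuation k a / ε) with hT
  refine ⟨valuation k a * T ^ p ^ j / ε, fun x G hx hG => ?_⟩
  rw [map_mul, map_pow]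
  rcases le_total (valuation k x) T with h | h
  · rw [div_le_iff₀ hε0, mul_comm G] at hG
    exact le_trans (mul_le_mul_right (pow_le_pow_left' h _) _) hG
  · have h1 : 1 ≤ valuation k x := (le_max_left _ _).trans h
    have h2 : valuation k a ≤ ε * valuation k x := by
      rw [mul_comm, ← div_le_iff₀ hε0]
      exact (le_max_right _ _).trans h
    calc valuation k a * valuation k x ^ p ^ j
        ≤ ε * valuation k x * valuation k x ^ p ^ j := mul_le_mul_left h2 _
      _ = ε * valuation k x ^ (p ^ j + 1) := by rw [pow_succ', mul_assoc]
      _ ≤ ε * valuation k x ^ p ^ m := by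
          refine mul_le_mul_right (pow_le_pow_right' h1 ?_) _
          exact Nat.pow_lt_pow_right (Fact.out : p.Prime).one_lt hjm
      _ ≤ ε * G := mul_le_mul_right hx _

theorem exists_lower_bound {ι : Type*} [Fintype ι] (a : ι → ℕ → k) (m : ι → ℕ)
    {ε : ValueGroupWithZero k} (hε : ε ≠ 0) :
    ∃ R : ValueGroupWithZero k, ∀ (x : ι → k) (G : ValueGroupWithZero k),
      (∀ i, valuation k (x i) ^ p ^ m i ≤ G) → R ≤ G →
        valuation k (∑ i, ∑ j ∈ Finset.range (m i), a i j * x i ^ p ^ j) ≤ ε * G := by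
  have : ∀ i j, ∃ R : ValueGroupWithZero k, j < m i → ∀ (x : k) (G : ValueGroupWithZero k),
      valuation k x ^ p ^ m i ≤ G → R ≤ G → valuation k (a i j * x ^ p ^ j) ≤ ε * G := by
    intro i j
    by_cases hj : j < m i
    · obtain ⟨R, hR⟩ := exists_lower_term_bound (p := p) (a i j) hj hε
      exact ⟨R, fun _ => hR⟩
    · exact ⟨0, fun h => absurd h hj⟩
  choose R hR using this
  refine ⟨Finset.univ.sup fun i => (Finset.range (m i)).sup (R i), fun x G hx hG => ?_⟩
  refine Valuation.map_sum_le _ fun i hi => Valuation.map_sum_le _ fun j hj => ?_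
  refine hR i j (Finset.mem_range.1 hj) (x i) G (hx i) (le_trans ?_ hG)
  exact (Finset.le_sup (f := R i) hj).trans
    (Finset.le_sup (f := fun i => (Finset.range (m i)).sup (R i)) hi)

variable [TopologicalSpace k] [IsNonarchimedeanLocalField k] [CharP k p]

/-- A subgroup containing the values of a separable additive polynomial in one variable is open. -/
theorem isOpen_of_separable {H : AddSubgroup k} {a : ℕ → k} {m : ℕ} (ha : a 0 ≠ 0)
    (h : ∀ t, ∑ j ∈ Finset.range (m + 1), a j * t ^ p ^ j ∈ H) : IsOpen (H : Set k) := by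
  have := t2Space_of_isNonarchimedeanLocalField k
  obtain ⟨π, hπ⟩ := exists_isUnif k
  let f : k →+ k := AddMonoidHom.mk' (fun t => ∑ j ∈ Finset.range (m + 1), a j * t ^ p ^ j)
    fun x y => by simp [add_pow_char_pow, mul_add, Finset.sum_add_distrib]
  have hf : ∀ t, f t = ∑ j ∈ Finset.range m, a (j + 1) * t ^ p ^ (j + 1) + a 0 * t := fun t => by
    change ∑ j ∈ Finset.range (m + 1), _ = _
    rw [Finset.sum_range_succ']
    simp
  have hfc : Continuous f := by
    change Continuous fun t => ∑ j ∈ Finset.range (m + 1), a j * t ^ p ^ j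
    fun_prop
  have hva : 0 < valuation k (a 0) := zero_lt_iff.2 ((Valuation.ne_zero_iff _).2 ha)
  set A : ValueGroupWithZero k := max 1 ((Finset.range m).sup fun j => valuation k (a (j + 1)))
  have hA : 0 < A := zero_lt_one.trans_le (le_max_left _ _)
  -- Small enough that on this ball the nonlinear terms are at most `|π| |a 0| |t|`; then `y / a 0`
  -- is an approximate preimage of `y`.
  set δ : ValueGroupWithZero k := min 1 (valuation k π * valuation k (a 0) / A)
  have hδ : 0 < δ := lt_min zero_lt_one (div_pos (mul_pos hπ.pos hva) hA)
  have hδA : A * δ ≤ valuation k π * valuation k (a 0) := by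
    rw [mul_comm, ← le_div_iff₀ hA]
    exact min_le_right _ _
  have hS : IsClosed (((closedBallSubgroup δ).map f : AddSubgroup k) : Set k) :=
    ((IsNonarchimedeanLocalField.isCompact_closedBall k δ).image hfc).isClosed
  refine isOpen_of_ball_subset (ρ := valuation k (a 0) * δ) (mul_pos hva hδ).ne' fun y hy => ?_
  suffices hmem : y ∈ (closedBallSubgroup δ).map f by
    obtain ⟨t, -, rfl⟩ := hmem
    exact h t
  refine mem_of_approx hπ hS (fun y hy => ?_) hy
  have ht : valuation k (y / a 0) ≤ δ := by
    rwa [map_div₀, div_le_iff₀ hva, mul_comm]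
  refine ⟨_, ⟨y / a 0, ht, rfl⟩, ?_⟩
  rw [hf, mul_div_cancel₀ _ ha, sub_add_cancel_right, Valuation.map_neg]
  refine Valuation.map_sum_le _ fun j hj => ?_
  have hy' : valuation k y = valuation k (a 0) * valuation k (y / a 0) := by
    rw [← map_mul, mul_div_cancel₀ _ ha]
  rw [hy', ← mul_assoc, map_mul, map_pow]
  set t := valuation k (y / a 0)
  calc valuation k (a (j + 1)) * t ^ p ^ (j + 1)
      ≤ A * (δ * t) := by
        refine mul_le_mul' ((Finset.le_sup (f := fun j => valuation k (a (j + 1))) hj).trans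
          (le_max_right _ _)) ?_
        refine (pow_le_pow_right_of_le_one' (ht.trans (min_le_left _ _)) (?_ : 2 ≤ _)).trans ?_
        · exact Nat.one_lt_pow (by simp) (Fact.out : p.Prime).one_lt
        · rw [pow_two]
          exact mul_le_mul_left ht _
    _ ≤ valuation k π * valuation k (a 0) * t := by
        rw [← mul_assoc]
        exact mul_le_mul_left hδA _

theorem finite_quotient_of_isOpen {H : AddSubgroup k} (hH : IsOpen (H : Set k))
    (R : ValueGroupWithZero k) (h : ∀ y, ∃ y', valuation k y' ≤ R ∧ y - y' ∈ H) :
    Finite (k ⧸ H) := by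
  have : DiscreteTopology (k ⧸ H) := QuotientAddGroup.discreteTopology hH
  have hc : IsCompact ((QuotientAddGroup.mk : k → k ⧸ H) '' {x | valuation k x ≤ R}) :=
    (IsNonarchimedeanLocalField.isCompact_closedBall k R).image continuous_quot_mk
  have huniv : (QuotientAddGroup.mk : k → k ⧸ H) '' {x | valuation k x ≤ R} = Set.univ := by
    refine Set.eq_univ_of_forall fun z => ?_
    obtain ⟨y, rfl⟩ := QuotientAddGroup.mk_surjective z
    obtain ⟨y', hy', hmem⟩ := h y
    refine ⟨y', hy', QuotientAddGroup.eq.2 ?_⟩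
    rwa [neg_add_eq_sub]
  rw [huniv] at hc
  exact Set.finite_univ_iff.1 hc.finite_of_discrete

variable {ι : Type*} [Fintype ι] {c : ι → k} {m : ι → ℕ}

/-- Modulo `H`, a large `y = F x` equals `-L x`, which is smaller by a factor `π`; repeating this
reaches a fixed ball. -/
theorem finite_quotient_of_surjective (hinj : Function.Injective (diagForm p c m))
    (hsurj : Function.Surjective (diagForm p c m)) {H : AddSubgroup k}
    (hH : IsOpen (H : Set k)) (a : ι → ℕ → k)
    (hmem : ∀ x, diagForm p c m x + ∑ i, ∑ j ∈ Finset.range (m i), a i j * x i ^ p ^ j ∈ H) :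
    Finite (k ⧸ H) := by
  obtain ⟨π, hπ⟩ := exists_isUnif k
  obtain ⟨C, hC0, hC⟩ := exists_bound_of_injective p hinj
  have hCpos : 0 < C := zero_lt_iff.2 hC0
  obtain ⟨R, hR⟩ := exists_lower_bound (p := p) a m
    (mul_ne_zero hπ.pos.ne' (inv_ne_zero hC0) : valuation k π * C⁻¹ ≠ 0)
  refine finite_quotient_of_isOpen hH (max 1 (R / C)) fun y => ?_
  have step : ∀ n : ℕ, ∀ y, valuation k π ^ n * valuation k y ≤ max 1 (R / C) →
      ∃ y', valuation k y' ≤ max 1 (R / C) ∧ y - y' ∈ H := by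
    intro n
    induction n with
    | zero => exact fun y hy => ⟨y, by simpa using hy, by simp⟩
    | succ n ih =>
      intro y hy
      rcases le_total (valuation k y) (max 1 (R / C)) with hle | hge
      · exact ⟨y, hle, by simp⟩
      obtain ⟨x, rfl⟩ := hsurj y
      have hL := hR x _ (hC x) (by
        have hge' := (le_max_right _ _).trans hge
        rwa [div_le_iff₀ hCpos, mul_comm] at hge')
      rw [mul_assoc, inv_mul_cancel_left₀ hC0] at hL
      set L := ∑ i, ∑ j ∈ Finset.range (m i), a i j * x i ^ p ^ j
      obtain ⟨y', hy', hyH⟩ := ih (-L) (by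
        rw [Valuation.map_neg]
        refine le_trans (mul_le_mul_right hL _) ?_
        rwa [← mul_assoc, ← pow_succ])
      refine ⟨y', hy', ?_⟩
      have := H.add_mem (hmem x) hyH
      convert this using 1
      ring
  obtain ⟨n, hn⟩ := exists_le_pow_uniformizer hπ (zero_lt_one.trans_le (le_max_left 1 (R / C))).ne' (valuation k y)
  exact step n y hn

/-- With `y₀` missed and `b` the chosen representative of `y₀ s ^ (p ^ M)`, some `x` gives `y₀ s ^
(p ^ M) - F x = L x + b`. For large `s` the lower bound for the extended form makes both `L x` and
`b` smaller than their sum, which is absurd. -/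
theorem surjective_of_finite_quotient (hinj : Function.Injective (diagForm p c m))
    {H : AddSubgroup k} [Finite (k ⧸ H)] (a : ι → ℕ → k)
    (hmem : ∀ z ∈ H, ∃ x,
      z = diagForm p c m x + ∑ i, ∑ j ∈ Finset.range (m i), a i j * x i ^ p ^ j) :
    Function.Surjective (diagForm p c m) := by
  by_contra hns
  obtain ⟨y₀, hy₀⟩ : ∃ y₀, y₀ ∉ Set.range (diagForm p c m) := by
    simpa [Function.Surjective] using hns
  obtain ⟨π, hπ⟩ := exists_isUnif k
  obtain ⟨M, hM⟩ : ∃ M, ∀ i, m i ≤ M :=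
    ⟨Finset.univ.sup m, fun i => Finset.le_sup (Finset.mem_univ i)⟩
  obtain ⟨C, hC0, hC⟩ := exists_bound_of_injective p (injective_diagForm_option p hM hinj hy₀)
  have hCpos : 0 < C := zero_lt_iff.2 hC0
  obtain ⟨R, hR⟩ := exists_lower_bound (p := p) a m
    (mul_ne_zero hπ.pos.ne' (inv_ne_zero hC0) : valuation k π * C⁻¹ ≠ 0)
  obtain ⟨B, hB⟩ : ∃ B, ∀ z : k ⧸ H, valuation k z.out ≤ B := by
    obtain ⟨B, hB⟩ := Set.finite_range (fun z : k ⧸ H => valuation k z.out) |>.bddAbove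
    exact ⟨B, fun z => hB ⟨z, rfl⟩⟩
  -- Beyond `D`: `1` gives `|s| ≤ |s| ^ (p ^ M)`, `R` makes the estimate for `L` available, and `C *
  -- B` forces `|b| < |L + b|`.
  set D : ValueGroupWithZero k := max 1 (max R (C * B))
  have hD : ∀ s : k, valuation k s ≤ D := by
    intro s
    by_contra hs
    rw [not_le] at hs
    set b := (QuotientAddGroup.mk (y₀ * s ^ p ^ M) : k ⧸ H).out
    have hb : valuation k b ≤ B := hB _
    obtain ⟨x, hx⟩ := hmem (y₀ * s ^ p ^ M - b) (by
      rw [← neg_add_eq_sub]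
      exact QuotientAddGroup.eq.1 (QuotientAddGroup.out_eq' _))
    set L := ∑ i, ∑ j ∈ Finset.range (m i), a i j * x i ^ p ^ j with hLdef
    have hval := hC fun o => o.elim s (-x)
    have heq : diagForm p (fun o : Option ι => o.elim y₀ c) (fun o => o.elim M m)
        (fun o => o.elim s (-x)) = L + b := by
      have : diagForm p (fun o : Option ι => o.elim y₀ c) (fun o => o.elim M m)
          (fun o => o.elim s (-x)) = y₀ * s ^ p ^ M + diagForm p c m (-x) := by
        rw [diagForm_apply, Fintype.sum_option, diagForm_apply]
        rfl
      rw [this, map_neg]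
      linear_combination hx
    rw [heq] at hval
    have h1 : D < C * valuation k (L + b) := by
      refine lt_of_lt_of_le (hs.trans_le ?_) (hval none)
      exact le_self_pow₀ ((le_max_left _ _).trans hs.le) (pow_ne_zero _ (Fact.out : p.Prime).ne_zero)
    have hL := hR x (C * valuation k (L + b)) (fun i => by simpa using hval (some i))
      (((le_max_left _ _).trans (le_max_right _ _)).trans h1.le)
    rw [← hLdef, mul_assoc, inv_mul_cancel_left₀ hC0] at hL
    have hpos : 0 < valuation k (L + b) := by
      rw [zero_lt_iff]
      rintro h0
      rw [h0, mul_zero] at h1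
      exact not_lt_zero h1
    have hL' : valuation k L < valuation k (L + b) :=
      hL.trans_lt (mul_lt_of_lt_one_left hpos hπ.lt_one)
    have hb' : valuation k b < valuation k (L + b) := by
      refine hb.trans_lt ?_
      have : C * B < C * valuation k (L + b) :=
        ((le_max_right _ _).trans (le_max_right _ _)).trans_lt h1
      exact lt_of_mul_lt_mul_left' this
    exact absurd (Valuation.map_add_lt _ hL' hb') (lt_irrefl _)
  -- Negative powers of `π` are unbounded, contradicting `hD`.
  obtain ⟨n, hn⟩ := exists_le_pow_uniformizer hπ one_ne_zero D
  have h1 := hD (π ^ (n + 1))⁻¹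
  rw [map_inv₀, map_pow, inv_le_iff_one_le_mul₀ (pow_pos hπ.pos _), pow_succ, mul_comm,
    mul_right_comm] at h1
  refine absurd h1 (not_le.2 ?_)
  exact (mul_le_of_le_one_left' hn).trans_lt hπ.lt_one

end Quotient

/-! ### Coefficients of a `p`-polynomial and its principal part -/

namespace PPoly

open MvPolynomial

section Coefficients

variable {σ k : Type*} [Fintype σ] [Field k] {p : ℕ}

theorem IsPPolynomial.exists_eq_sum {P : MvPolynomial σ k} (hP : IsPPolynomial p P) :
    ∃ a : σ → ℕ →₀ k, P = ∑ i, (a i).sum fun j c => C c * X i ^ p ^ j := by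
  classical
  unfold IsPPolynomial at hP
  induction hP using Submodule.span_induction with
  | mem Q hQ =>
    obtain ⟨i, j, rfl⟩ := hQ
    refine ⟨Pi.single i (Finsupp.single j 1), ?_⟩
    rw [Finset.sum_eq_single i]
    · rw [Pi.single_eq_same, Finsupp.sum_single_index (by simp)]
      simp
    · intro l _ hl
      rw [Pi.single_eq_of_ne hl, Finsupp.sum_zero_index]
    · simp
  | zero => exact ⟨0, by simp⟩
  | add Q R _ _ hQ hR =>
    obtain ⟨a, rfl⟩ := hQ
    obtain ⟨b, rfl⟩ := hR
    refine ⟨a + b, ?_⟩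
    rw [← Finset.sum_add_distrib]
    refine Finset.sum_congr rfl fun i _ => ?_
    rw [Pi.add_apply, Finsupp.sum_add_index' (by simp) (by simp [add_mul])]
  | smul t Q _ hQ =>
    obtain ⟨a, rfl⟩ := hQ
    refine ⟨t • a, ?_⟩
    rw [Finset.smul_sum]
    refine Finset.sum_congr rfl fun i _ => ?_
    rw [Pi.smul_apply, Finsupp.sum_smul_index' (by simp), Finsupp.smul_sum]
    simp [smul_eq_C_mul, mul_assoc]

theorem coeff_single_C_mul_X_pow {σ : Type*} [DecidableEq σ] (c : k) (i l : σ) {d e : ℕ} (he : e ≠ 0) :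
    coeff (Finsupp.single l e) (C c * X i ^ d : MvPolynomial σ k) =
      if i = l ∧ d = e then c else 0 := by
  rw [coeff_C_mul, coeff_X_pow, mul_ite, mul_one, mul_zero]
  congr 1
  rw [Finsupp.single_eq_single_iff]
  simp only [eq_iff_iff]
  constructor
  · rintro (h | h)
    · exact h
    · exact absurd h.2 he
  · exact Or.inl

theorem IsPPolynomial.eval_eq [Fact p.Prime] {P : MvPolynomial σ k} (hP : IsPPolynomial p P)
    (m : σ → ℕ) (hm : ∀ i, P.degreeOf i ≤ p ^ m i) (x : σ → k) :
    eval x P = ∑ i, ∑ j ∈ Finset.range (m i + 1),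
      P.coeff (Finsupp.single i (p ^ j)) * x i ^ p ^ j := by
  classical
  have hp := (Fact.out : p.Prime)
  obtain ⟨a, ha⟩ := hP.exists_eq_sum
  have hcoeff : ∀ i j, P.coeff (Finsupp.single i (p ^ j)) = a i j := by
    intro i j
    rw [ha, coeff_sum, Finset.sum_eq_single i]
    · rw [Finsupp.sum, coeff_sum]
      simp only [coeff_single_C_mul_X_pow _ _ _ (pow_ne_zero j hp.ne_zero), true_and,
        Nat.pow_right_inj hp.two_le]
      simp +contextual [eq_comm]
    · intro l _ hl
      rw [Finsupp.sum, coeff_sum]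
      simp [coeff_single_C_mul_X_pow _ _ _ (pow_ne_zero j hp.ne_zero), hl]
    · simp
  simp only [hcoeff]
  conv_lhs => rw [ha]
  rw [map_sum]
  refine Finset.sum_congr rfl fun i _ => ?_
  rw [Finsupp.sum, map_sum]
  simp only [map_mul, map_pow, eval_C, eval_X]
  refine Finset.sum_subset ?_ ?_
  · intro j hj
    rw [Finsupp.mem_support_iff, ← hcoeff, ← mem_support_iff] at hj
    have := (monomial_le_degreeOf i hj).trans (hm i)
    rw [Finsupp.single_eq_same, Nat.pow_le_pow_iff_right hp.one_lt] at this
    exact Finset.mem_range.2 (Nat.lt_succ_of_le this)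
  · intro j _ hj
    rw [Finsupp.notMem_support_iff.1 hj, zero_mul]

/-- If the principal part of `P` is `∑ c_i x_i ^ d_i` with nonzero coefficients, then `x_i` has
degree `d_i` in `P`, with leading coefficient `c_i`. -/
theorem degreeOf_eq_of_principalPart_eq {P : MvPolynomial σ k} {c : σ → k} {d : σ → ℕ}
    (hd : ∀ i, d i ≠ 0) (hc : ∀ i, c i ≠ 0)
    (h : principalPart P = ∑ i, C (c i) * X i ^ d i) (i : σ) :
    P.degreeOf i = d i ∧ P.coeff (Finsupp.single i (d i)) = c i := by
  classical
  have h1 := congrArg (coeff (Finsupp.single i (d i))) h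
  rw [principalPart, coeff_sum, coeff_sum] at h1
  simp only [coeff_single_C_mul_X_pow _ _ _ (hd i)] at h1
  rw [Finset.sum_eq_single i (by simp +contextual) (by simp),
    Finset.sum_eq_single i (by simp +contextual) (by simp)] at h1
  simp only [true_and, if_true] at h1
  split_ifs at h1 with h2
  · exact ⟨h2, h2 ▸ h1⟩
  · exact absurd h1.symm (hc i)

end Coefficients

end PPoly

/-! ### Assembly of the theorem -/

theorem sum_card_fiber_pow (p M : ℕ) {n : ℕ} (b : Fin n → ℕ) (hb : ∀ i, b i ∈ Finset.Icc 1 M)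
    (r : ℕ → ℕ) (hr : ∀ j ∈ Finset.Icc 1 M, r j = (Finset.univ.filter fun i => b i = j).card) :
    ∑ j ∈ Finset.Icc 1 M, p ^ (j - 1) * r j = ∑ i, p ^ (M - (M - b i + 1)) := by
  rw [← Finset.sum_fiberwise_of_maps_to (fun i _ => hb i) fun i => p ^ (M - (M - b i + 1))]
  refine Finset.sum_congr rfl fun j hj => ?_
  rw [hr j hj, mul_comm, ← smul_eq_mul, ← Finset.sum_const]
  refine Finset.sum_congr rfl fun i hi => ?_
  rw [(Finset.mem_filter.1 hi).2]
  rw [Finset.mem_Icc] at hj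
  congr 1
  omega

theorem lemma4 (p : ℕ) [Fact p.Prime]
    (k : Type*) [Field k] [ValuativeRel k] [TopologicalSpace k] [IsNonarchimedeanLocalField k]
    [CharP k p]
    (n M : ℕ) (P : MvPolynomial (Fin n) k)
    (hP : PPoly.IsPPolynomial p P) (hsep : PPoly.IsSeparable P)
    -- the `i`-th variable has exponent `p ^ (M - b i + 1)` in the principal part, `1 ≤ b i ≤ M`
    (b : Fin n → ℕ) (hb : ∀ i, b i ∈ Finset.Icc 1 M) (c : Fin n → k)
    (hprinc : PPoly.principalPart P =
      ∑ i, MvPolynomial.C (c i) * MvPolynomial.X i ^ p ^ (M - b i + 1))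
    -- `r j` variables have exponent `p ^ (M - j + 1)`
    (r : ℕ → ℕ) (hr : ∀ j ∈ Finset.Icc 1 M, r j = (Finset.univ.filter fun i => b i = j).card)
    (hnv : ∀ x : Fin n → k, x ≠ 0 → MvPolynomial.eval x (PPoly.principalPart P) ≠ 0) :
    ∑ j ∈ Finset.Icc 1 M, p ^ (j - 1) * r j ≤ p ^ M ∧
      (∑ j ∈ Finset.Icc 1 M, p ^ (j - 1) * r j = p ^ M ↔ Finite (k ⧸ PPoly.im hP)) := by
  have hp := (Fact.out : p.Prime)
  set m : Fin n → ℕ := fun i => M - b i + 1 with hm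
  have hmM : ∀ i, m i ≤ M := fun i => by
    have := Finset.mem_Icc.1 (hb i)
    simp only [hm]
    omega
  have hpm : ∀ i, p ^ m i ≠ 0 := fun i => pow_ne_zero _ hp.ne_zero
  have heval : ∀ x, MvPolynomial.eval x (PPoly.principalPart P) = diagForm p c m x := fun x => by
    rw [hprinc, map_sum, diagForm_apply]
    simp [hm]
  have hinj : Function.Injective (diagForm p c m) := by
    rw [injective_iff_map_eq_zero]
    intro x hx
    by_contra h0
    exact hnv x h0 ((heval x).trans hx)
  have hc : ∀ i, c i ≠ 0 := fun i h0 => by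
    refine hnv (Pi.single i 1) (by simp) ?_
    rw [heval, diagForm_apply, Finset.sum_eq_single i]
    · simp [h0]
    · intro l _ hl
      rw [Pi.single_eq_of_ne hl, zero_pow (hpm l), mul_zero]
    · simp
  have hdeg := PPoly.degreeOf_eq_of_principalPart_eq hpm hc hprinc
  let a : Fin n → ℕ → k := fun i j => P.coeff (Finsupp.single i (p ^ j))
  have hPeval := hP.eval_eq m fun i => (hdeg i).1.le
  have hsplit : ∀ x, MvPolynomial.eval x P =
      diagForm p c m x + ∑ i, ∑ j ∈ Finset.range (m i), a i j * x i ^ p ^ j := fun x => by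
    rw [hPeval, diagForm_apply, ← Finset.sum_add_distrib]
    refine Finset.sum_congr rfl fun i _ => ?_
    rw [Finset.sum_range_succ, (hdeg i).2, add_comm]
  -- Restricting `P` to the axis of a variable with nonzero linear coefficient gives a separable
  -- polynomial in one variable.
  have hopen : IsOpen (PPoly.im hP : Set k) := by
    obtain ⟨i, hi⟩ := hsep
    refine isOpen_of_separable (p := p) (a := a i) (m := m i) (by simpa [a] using hi) fun t => ?_
    refine ⟨Pi.single i t, ?_⟩
    change MvPolynomial.eval (Pi.single i t) P = _
    rw [hPeval, Finset.sum_eq_single i]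
    · simp [a]
    · intro l _ hl
      refine Finset.sum_eq_zero fun j _ => ?_
      rw [Pi.single_eq_of_ne hl, zero_pow (pow_ne_zero _ hp.ne_zero), mul_zero]
    · simp
  rw [sum_card_fiber_pow p M b hb r hr]
  refine ⟨sum_pow_le_of_injective p hmM hinj, ?_⟩
  rw [← surjective_iff_sum_pow_eq p hmM hinj]
  constructor
  · intro hsurj
    exact finite_quotient_of_surjective hinj hsurj hopen a fun x => ⟨x, hsplit x⟩
  · intro hfin
    refine surjective_of_finite_quotient hinj a (H := PPoly.im hP) ?_
    rintro _ ⟨x, rfl⟩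
    exact ⟨x, hsplit x⟩
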